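/- Let $s,m\ge 1$ be integers, $b$ a prime, $N=b^m$, and $0=w_1\le w_2\le w_3\le\cdots$ integers. Let $\mathcal Z_N=\{z\in\{1,\dots,N-1\}:\gcd(z,N)=1\}$; let $\mathcal Z_{N,w_j}=\{z\in\{1,\dots,b^{m-w_j}-1\}:\gcd(z,b^m)=1\}$ if $w_j<m$, and $\mathcal Z_{N,w_j}=\{1\}$ otherwise. Let $\alpha>1$ be real, let $\gamma_1,\gamma_2,\dots>0$, and put $\gamma_{\mathfrak u}=\prod_{j\in\mathfrak u}\gamma_j$. For $d\ge1$ and $\boldsymbol h\in\mathbb Z^d$ put $r_\alpha(\boldsymbol h)=\prod_{j=1}^d r_\alpha(\gamma_j,h_j)$, where $r_\alpha(\gamma_j,0)=1$ and $r_\alpha(\gamma_j,h)=\gamma_j|h|^{-\alpha}$ for $h\ne0$. The weighted Korobov space $\mathcal H_d$ consists of the functions $f:[0,1]^d\to\mathbb C$ that are everywhere the sum of their Fourier series $\sum_{\boldsymbol h\in\mathbb Z^d}\hat f(\boldsymbol h)e^{2\pi i\boldsymbol h\cdot\boldsymbol x}$ and satisfy $\|f\|_{\mathcal H_d}^2=\sum_{\boldsymbol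 h\in\mathbb Z^d}r_\alpha(\boldsymbol h)^{-1}|\hat f(\boldsymbol h)|^2<\infty$; it is the reproducing kernel Hilbert space with kernel $\sum_{\boldsymbol h\in\mathbb Z^d}r_\alpha(\boldsymbol h)e^{2\pi i\boldsymbol h\cdot(\boldsymbol x-\boldsymbol y)}$. For integers $z_1,\dots,z_d\ge0$ let $$e(z_1,\dots,z_d)=\sup_{\|f\|_{\mathcal H_d}\le1}\Big|\int_{[0,1]^d}f(\boldsymbol x)\,d\boldsymbol x-\frac1N\sum_{k=0}^{N-1}f\Big(\Big\{\frac{k\boldsymbol z}{N}\Big\}\Big)\Big|,$$ where $\{\cdot\}$ is the componentwise fractional part. Let $\tilde{\boldsymbol z}=(\tilde z_1,\dots,\tilde z_s)$ be constructed by the following algorithm. Set $\mathcal E_1=\emptyset$ and $\tilde z_1=z_1=1$. For $j=2,\dots,s$ in turn: - if $w_j<m$, choose any $\mathcal E_j\subsetneq\mathcal Z_{N,w_j}$, choose $z_j\in\mathcal Z_{N,w_j}\setminus\mathcal E_j$ such that $e^2(\tilde z_1,\dots,\tilde z_{j-1},b^{w_j}z_j)$ is minimal among all elements of $\mathcal Z_{N,w_j}\setminus\mathcal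 E_j$, and set $\tilde z_j=b^{w_j}z_j$; - if $w_j\ge m$, set $\mathcal E_j=\emptyset$ and $\tilde z_j=z_j=0$. For $1\le j\le s$ define the auxiliary exclusion sets $\tilde{\mathcal E}_j=(\mathcal Z_N\setminus\mathcal Z_{N,w_j})\cup\mathcal E_j$. Then for all $1\le d\le s$ and all real $\lambda$ with $1/\alpha<\lambda\le1$, $$e^2(\tilde z_1,\dots,\tilde z_d)\le\Big(\frac1{\phi(N)}\sum_{\mathfrak u\subseteq\{1,\dots,d\}}\gamma_{\mathfrak u}^\lambda\,(2\zeta(\alpha\lambda))^{|\mathfrak u|}\prod_{j\in\mathfrak u}\frac{\phi(N)}{\phi(N)-|\tilde{\mathcal E}_j|}\Big)^{1/\lambda},$$ where $\phi$ is Euler's totient function, $\zeta$ is the Riemann zeta function, and empty products equal $1$. -/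

import Mathlib

open scoped BigOperators ENNReal

namespace CombinedCBC

/-! Sequences such as the weights `γ`, the reduction indices `w`, the exclusion sets `E` and the
generating vector are indexed by `j = 1, 2, 3, …`; their value at `0` is never used. The coordinate
`i : Fin d` of a point of `ℝ ^ d` is the coordinate with number `i + 1`. -/

/-- The dot product of an integer vector and a real vector. -/
noncomputable def dot {d : ℕ} (h : Fin d → ℤ) (x : Fin d → ℝ) : ℝ :=
  ∑ i, (h i : ℝ) * x i

/-- The one-dimensional function `r_α(γ, h)`. -/
noncomputable def rOne (α γ : ℝ) (h : ℤ) : ℝ :=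
  if h = 0 then 1 else γ / |(h : ℝ)| ^ α

/-- The function `r_α(γ, h)` for an integer vector `h`, with product weights. -/
noncomputable def r (α : ℝ) (γ : ℕ → ℝ) {d : ℕ} (h : Fin d → ℤ) : ℝ :=
  ∏ i : Fin d, rOne α (γ (i + 1)) (h i)

/-- The `h`-th Fourier coefficient of a function on the unit cube. -/
noncomputable def fourierCoef {d : ℕ} (f : (Fin d → ℝ) → ℂ) (h : Fin d → ℤ) : ℂ :=
  ∫ x in Set.Icc (0 : Fin d → ℝ) 1, f x * Complex.exp (-2 * Real.pi * Complex.I * dot h x)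

/-- The weighted Korobov space in dimension `d`: functions on the unit cube which are everywhere
the sum of their Fourier series and for which `∑ |f̂(h)|² / r_α(γ, h)` is finite. For `α > 1` and
positive weights this is the reproducing kernel Hilbert space with kernel
`K(x, y) = ∑ r_α(γ, h) exp(2πi h·(x - y))`, the sum being over all integer vectors `h`. Values of
`f` outside the unit cube are irrelevant. -/
def korobovSpace (α : ℝ) (γ : ℕ → ℝ) (d : ℕ) : Set ((Fin d → ℝ) → ℂ) :=
  {f | Summable (fun h : Fin d → ℤ => ‖fourierCoef f h‖ ^ 2 / r α γ h) ∧
    ∀ x ∈ Set.Icc (0 : Fin d → ℝ) 1,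
      HasSum (fun h : Fin d → ℤ =>
        fourierCoef f h * Complex.exp (2 * Real.pi * Complex.I * dot h x)) (f x)}

/-- The norm of the weighted Korobov space. -/
noncomputable def korobovNorm (α : ℝ) (γ : ℕ → ℝ) {d : ℕ} (f : (Fin d → ℝ) → ℂ) : ℝ :=
  Real.sqrt (∑' h : Fin d → ℤ, ‖fourierCoef f h‖ ^ 2 / r α γ h)

/-- The `k`-th point `{k z / N}` of the `d`-dimensional rank-1 lattice point set generated by
`(z 1, …, z d)`. -/
noncomputable def latticePoint (N : ℕ) (z : ℕ → ℕ) (d k : ℕ) : Fin d → ℝ :=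
  fun i => Int.fract ((k : ℝ) * (z (i + 1) : ℝ) / (N : ℝ))

/-- The worst-case integration error `e(z 1, …, z d)` in the `d`-dimensional weighted Korobov
space, a supremum in `[0, ∞]`. -/
noncomputable def worstCaseError (N : ℕ) (α : ℝ) (γ : ℕ → ℝ) (z : ℕ → ℕ) (d : ℕ) : ℝ≥0∞ :=
  ⨆ f ∈ {f ∈ korobovSpace α γ d | korobovNorm α γ f ≤ 1},
    ‖(∫ x in Set.Icc (0 : Fin d → ℝ) 1, f x) -
      (1 / (N : ℂ)) * ∑ k ∈ Finset.range N, f (latticePoint N z d k)‖ₑ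

/-- The full search space `𝒵_N`. -/
def searchSpace (N : ℕ) : Finset ℕ :=
  (Finset.Icc 1 (N - 1)).filter (fun z => Nat.gcd z N = 1)

/-- The reduced search space `𝒵_{N, w}` for `N = b ^ m`. -/
def reducedSpace (b m w : ℕ) : Finset ℕ :=
  if w < m then (Finset.Icc 1 (b ^ (m - w) - 1)).filter (fun z => Nat.gcd z (b ^ m) = 1)
  else {1}

/-- The auxiliary exclusion set `(𝒵_N ∖ 𝒵_{N, w}) ∪ ℰ` for `N = b ^ m`. -/
def auxExclusion (b m w : ℕ) (E : Finset ℕ) : Finset ℕ :=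
  (searchSpace (b ^ m) \ reducedSpace b m w) ∪ E

/-- `IsOutput b m w α γ s E z zt` says that a run of the combined component-by-component
algorithm with exclusion sets `E 1, …, E s` can choose `z 1, …, z s` and produce the vector
`(zt 1, …, zt s)`. For `w j = 0` one has `𝒵_{N, w j} = 𝒵_N` and `b ^ w j = 1`, so the steps for
`2 ≤ j ≤ t₁` (where `w j = 0`) and for `t₁ < j < t₂` (where `0 < w j < m`) have the same form;
`j ≥ t₂` means `w j ≥ m`. -/
structure IsOutput (b m : ℕ) (w : ℕ → ℕ) (α : ℝ) (γ : ℕ → ℝ) (s : ℕ)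
    (E : ℕ → Finset ℕ) (z zt : ℕ → ℕ) : Prop where
  exclusion_one : E 1 = ∅
  z_one : z 1 = 1
  zt_one : zt 1 = z 1
  exclusion_ssubset : ∀ j, 2 ≤ j → j ≤ s → w j < m → E j ⊂ reducedSpace b m (w j)
  z_mem : ∀ j, 2 ≤ j → j ≤ s → w j < m → z j ∈ reducedSpace b m (w j) \ E j
  z_min : ∀ j, 2 ≤ j → j ≤ s → w j < m → ∀ y ∈ reducedSpace b m (w j) \ E j,
    worstCaseError (b ^ m) α γ (Function.update zt j (b ^ w j * z j)) j ^ 2 ≤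
      worstCaseError (b ^ m) α γ (Function.update zt j (b ^ w j * y)) j ^ 2
  zt_eq : ∀ j, 2 ≤ j → j ≤ s → w j < m → zt j = b ^ w j * z j
  exclusion_late : ∀ j, 2 ≤ j → j ≤ s → m ≤ w j → E j = ∅
  z_late : ∀ j, 2 ≤ j → j ≤ s → m ≤ w j → z j = 0
  zt_late : ∀ j, 2 ≤ j → j ≤ s → m ≤ w j → zt j = z j

end CombinedCBC

/-!
The squared worst-case error in the Korobov space is the sum of `r_α(γ, h)` over the nonzero
frequencies `h` of the dual lattice `{h : h · z ≡ 0 mod N}` (`worstCaseError_sq_eq_dualSum`): the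
lattice rule sends the character of frequency `h` to `1` or `0` according to whether `h` is in the
dual lattice, so the error functional is minus a sum of Fourier coefficients. The Cauchy–Schwarz
inequality bounds it from above, and normalized trigonometric polynomials show that the bound is
attained in the limit. All these sums are taken in `[0, ∞]`, so that they may be split and
interchanged freely; their finiteness is a by-product of the bound.

When a component is appended to the generating vector, the dual sum grows by `lastSum`, the
contribution of the frequencies with nonzero last entry (`dualSum_succ`). The algorithm minimizes
this contribution over the candidates `y` in `𝒵_{N, w} ∖ ℰ`, so its `lam`-th power is at most the
average of the `lam`-th powers over the candidates. By Jensen's inequality the `lam`-th power may be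
moved inside the sums, and the sum over the candidates may be extended to all of `𝒵_{N, w}`. There
remains a counting problem: for every residue `c`, the sum of `|k| ^ (-β)` over the solutions of
`c + k b ^ w y ≡ 0 mod b ^ m` with `y` in `𝒵_{N, w}` and `k ≠ 0` is at most `2 ζ(β)`
(`sum_reducedSpace_tsum_absPow_le`). With `M = b ^ (m - w)`, every such `k` has the same greatest
common divisor `g` with `M`, because `y` is a unit modulo `M`; each `k` belongs to at most `g`
values of `y`; and `g ∑_{g ∣ k} |k| ^ (-β) = g ^ (1 - β) 2 ζ(β)`.

As `φ(N) - |ℰ̃|` is the number of candidates (`totient_sub_card_auxExclusion`), an induction on the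
dimension, starting from the empty vector with dual sum `0`, gives
`(dualSum d) ^ lam ≤ φ(N)⁻¹ ∏ (1 + γ_j ^ lam 2 ζ(α lam) φ(N) / (φ(N) - |ℰ̃_j|))`
(`IsOutput.dualSum_rpow_le`), and expanding the product gives the sum over subsets.
-/

namespace CombinedCBC
open MeasureTheory

/-! ### Trigonometric polynomials and their Fourier coefficients -/

theorem exp_dot_eq_prod {d : ℕ} (h : Fin d → ℤ) (x : Fin d → ℝ) :
    Complex.exp (2 * Real.pi * Complex.I * dot h x) =
      ∏ i, Complex.exp (2 * Real.pi * Complex.I * h i * x i) := by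
  rw [← Complex.exp_sum, dot]
  push_cast
  rw [Finset.mul_sum]
  simp only [mul_assoc]

theorem integral_exp_unitInterval (k : ℤ) :
    ∫ x in Set.Icc (0 : ℝ) 1, Complex.exp (2 * Real.pi * Complex.I * k * x) =
      if k = 0 then 1 else 0 := by
  rw [integral_Icc_eq_integral_Ioc, ← intervalIntegral.integral_of_le zero_le_one]
  split_ifs with hk
  · simp [hk]
  · have hc : (2 * Real.pi * Complex.I * k : ℂ) ≠ 0 := by
      simp [Real.pi_ne_zero, hk]
    rw [integral_exp_mul_complex hc]
    have : Complex.exp (2 * Real.pi * Complex.I * k) = 1 :=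
      Complex.exp_eq_one_iff.2 ⟨k, by ring⟩
    simp [this]

theorem integral_exp_dot {d : ℕ} (h : Fin d → ℤ) :
    ∫ x in Set.Icc (0 : Fin d → ℝ) 1, Complex.exp (2 * Real.pi * Complex.I * dot h x) =
      if h = 0 then 1 else 0 := by
  simp only [exp_dot_eq_prod]
  rw [← Set.pi_univ_Icc, volume_pi, Measure.restrict_pi_pi]
  simp only [Pi.zero_apply, Pi.one_apply]
  rw [integral_fintype_prod_eq_prod
    (f := fun i (x : ℝ) => Complex.exp (2 * Real.pi * Complex.I * h i * x))]
  simp only [integral_exp_unitInterval]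
  rw [Finset.prod_ite_zero]
  simp [funext_iff]

theorem dot_sub {d : ℕ} (h k : Fin d → ℤ) (x : Fin d → ℝ) :
    dot (h - k) x = dot h x - dot k x := by
  simp [dot, sub_mul, Finset.sum_sub_distrib]

theorem continuous_exp_dot {d : ℕ} (h : Fin d → ℤ) :
    Continuous fun x : Fin d → ℝ => Complex.exp (2 * Real.pi * Complex.I * dot h x) := by
  unfold dot
  fun_prop

/-- The trigonometric polynomial with coefficients `a` on the finite frequency set `F`. -/
noncomputable def trigPoly {d : ℕ} (F : Finset (Fin d → ℤ)) (a : (Fin d → ℤ) → ℂ)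
    (x : Fin d → ℝ) : ℂ :=
  ∑ k ∈ F, a k * Complex.exp (2 * Real.pi * Complex.I * dot k x)

/-- Orthogonality of the characters on the unit cube. -/
theorem fourierCoef_trigPoly {d : ℕ} (F : Finset (Fin d → ℤ)) (a : (Fin d → ℤ) → ℂ)
    (h : Fin d → ℤ) : fourierCoef (trigPoly F a) h = if h ∈ F then a h else 0 := by
  have key : ∀ x : Fin d → ℝ,
      trigPoly F a x * Complex.exp (-2 * Real.pi * Complex.I * dot h x) =
        ∑ k ∈ F, a k * Complex.exp (2 * Real.pi * Complex.I * dot (k - h) x) := by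
    intro x
    rw [trigPoly, Finset.sum_mul]
    refine Finset.sum_congr rfl fun k _ => ?_
    rw [mul_assoc, ← Complex.exp_add, dot_sub]
    congr 2
    push_cast
    ring
  simp only [fourierCoef, key]
  rw [integral_finsetSum]
  · simp only [integral_const_mul, integral_exp_dot, sub_eq_zero]
    simp
  · intro k _
    exact ((continuous_exp_dot _).const_mul _).continuousOn.integrableOn_compact isCompact_Icc

theorem integral_eq_fourierCoef_zero {d : ℕ} (f : (Fin d → ℝ) → ℂ) :
    ∫ x in Set.Icc (0 : Fin d → ℝ) 1, f x = fourierCoef f 0 := by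
  simp [fourierCoef, dot]

/-! ### The action of the lattice rule on characters -/

/-- The inner product `h · z` of a frequency with the generating vector. -/
def intDot {d : ℕ} (h : Fin d → ℤ) (z : ℕ → ℕ) : ℤ :=
  ∑ i : Fin d, h i * (z (i + 1) : ℤ)

theorem exp_dot_latticePoint (N : ℕ) (z : ℕ → ℕ) {d : ℕ} (h : Fin d → ℤ) (k : ℕ) :
    Complex.exp (2 * Real.pi * Complex.I * dot h (latticePoint N z d k)) =
      Complex.exp (2 * Real.pi * Complex.I * (intDot h z / N)) ^ k := by
  -- Passing from `k z / N` to its fractional part changes `h · x` by an integer.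
  rw [← Complex.exp_nat_mul, Complex.exp_eq_exp_iff_exists_int]
  refine ⟨-∑ i : Fin d, h i * ⌊(k : ℝ) * (z (i + 1) : ℝ) / (N : ℝ)⌋, ?_⟩
  have : dot h (latticePoint N z d k) = k * ((intDot h z : ℝ) / N) -
      ((∑ i : Fin d, h i * ⌊(k : ℝ) * (z (i + 1) : ℝ) / (N : ℝ)⌋ : ℤ) : ℝ) := by
    simp only [dot, latticePoint, intDot, Int.fract]
    push_cast
    rw [Finset.sum_div, Finset.mul_sum, ← Finset.sum_sub_distrib]
    refine Finset.sum_congr rfl fun i _ => ?_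
    ring
  rw [this]
  push_cast
  ring

theorem sum_exp_dot_latticePoint (N : ℕ) (hN : 0 < N) (z : ℕ → ℕ) {d : ℕ} (h : Fin d → ℤ) :
    ∑ k ∈ Finset.range N, Complex.exp (2 * Real.pi * Complex.I * dot h (latticePoint N z d k)) =
      if (N : ℤ) ∣ intDot h z then (N : ℂ) else 0 := by
  have hNC : (N : ℂ) ≠ 0 := by exact_mod_cast hN.ne'
  have hpi : (2 * Real.pi * Complex.I : ℂ) ≠ 0 := by simp [Real.pi_ne_zero]
  simp only [exp_dot_latticePoint]
  have h1 : Complex.exp (2 * Real.pi * Complex.I * (intDot h z / N)) = 1 ↔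
      (N : ℤ) ∣ intDot h z := by
    rw [Complex.exp_eq_one_iff]
    constructor
    · rintro ⟨n, hn⟩
      refine ⟨n, ?_⟩
      rw [mul_comm, mul_left_inj' hpi, div_eq_iff hNC] at hn
      rw [mul_comm]
      exact_mod_cast hn
    · rintro ⟨n, hn⟩
      refine ⟨n, ?_⟩
      rw [hn]
      push_cast
      field_simp
  split_ifs with hd
  · rw [h1.2 hd]
    simp
  · rw [geom_sum_eq (fun h => hd (h1.1 h)), ← Complex.exp_nat_mul]
    have : Complex.exp (N * (2 * Real.pi * Complex.I * (intDot h z / N))) = 1 := by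
      rw [Complex.exp_eq_one_iff]
      exact ⟨intDot h z, by field_simp⟩
    simp [this]

theorem latticePoint_mem (N : ℕ) (z : ℕ → ℕ) (d k : ℕ) :
    latticePoint N z d k ∈ Set.Icc (0 : Fin d → ℝ) 1 :=
  ⟨fun _ => Int.fract_nonneg _, fun _ => (Int.fract_lt_one _).le⟩

/-- The lattice rule integrates each character exactly or to `1`, so the integration error is minus
the sum of the Fourier coefficients over the nonzero frequencies of the dual lattice. -/
theorem hasSum_error (N : ℕ) (hN : 0 < N) (z : ℕ → ℕ) {α : ℝ} {γ : ℕ → ℝ} {d : ℕ}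
    {f : (Fin d → ℝ) → ℂ} (hf : f ∈ korobovSpace α γ d) :
    HasSum (fun h : Fin d → ℤ => if h ≠ 0 ∧ (N : ℤ) ∣ intDot h z then -fourierCoef f h else 0)
      ((∫ x in Set.Icc (0 : Fin d → ℝ) 1, f x) -
        (1 / (N : ℂ)) * ∑ k ∈ Finset.range N, f (latticePoint N z d k)) := by
  have hNC : (N : ℂ) ≠ 0 := by exact_mod_cast hN.ne'
  have h1 := (hasSum_sum (s := Finset.range N) fun k _ =>
    hf.2 _ (latticePoint_mem N z d k)).mul_left (1 / (N : ℂ))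
  have h2 := (hasSum_ite_eq (0 : Fin d → ℤ) (fourierCoef f 0)).sub h1
  rw [integral_eq_fourierCoef_zero]
  refine (congrArg (HasSum · _) (funext fun h => ?_)).mpr h2
  rw [← Finset.mul_sum, sum_exp_dot_latticePoint N hN]
  by_cases h0 : h = 0
  · simp [h0, intDot]
    field_simp
    simp
  · by_cases hd : (N : ℤ) ∣ intDot h z
    · simp only [h0, hd, if_true, if_false]
      simp [h0]
      field_simp
    · simp [h0, hd]

/-! ### The worst-case error as a sum over the dual lattice -/

theorem rOne_pos {α γ : ℝ} (hγ : 0 < γ) (k : ℤ) : 0 < rOne α γ k := by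
  unfold rOne
  split_ifs with hk
  · exact one_pos
  · have : (0 : ℝ) < |(k : ℝ)| := abs_pos.2 (by exact_mod_cast hk)
    positivity

theorem r_pos {α : ℝ} {γ : ℕ → ℝ} (hγ : ∀ j, 1 ≤ j → 0 < γ j) {d : ℕ} (h : Fin d → ℤ) :
    0 < r α γ h :=
  Finset.prod_pos fun _ _ => rOne_pos (hγ _ (by omega)) _

/-- The sum of `r_α(γ, h)` over the nonzero frequencies `h` of the dual lattice, in `[0, ∞]`. -/
noncomputable def dualSum (N : ℕ) (α : ℝ) (γ : ℕ → ℝ) (z : ℕ → ℕ) (d : ℕ) : ℝ≥0∞ :=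
  ∑' h : Fin d → ℤ, if h ≠ 0 ∧ (N : ℤ) ∣ intDot h z then ENNReal.ofReal (r α γ h) else 0

/-- The Cauchy–Schwarz inequality in `[0, ∞]`. -/
theorem sq_tsum_mul_le {ι : Type*} (u v : ι → ℝ≥0∞) :
    (∑' i, u i * v i) ^ 2 ≤ (∑' i, u i ^ 2) * ∑' i, v i ^ 2 := by
  have hc : Real.HolderConjugate 2 2 := Real.HolderConjugate.two_two
  have key : ∑' i, u i * v i ≤ (∑' i, u i ^ 2) ^ (1 / 2 : ℝ) * (∑' i, v i ^ 2) ^ (1 / 2 : ℝ) := by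
    refine ENNReal.summable.tsum_le_of_sum_le fun s => ?_
    refine (ENNReal.inner_le_Lp_mul_Lq s u v hc).trans ?_
    simp only [ENNReal.rpow_two]
    gcongr <;> exact ENNReal.sum_le_tsum s
  calc _ ≤ ((∑' i, u i ^ 2) ^ (1 / 2 : ℝ) * (∑' i, v i ^ 2) ^ (1 / 2 : ℝ)) ^ 2 := by gcongr
    _ = _ := by
      rw [mul_pow, ← ENNReal.rpow_two, ← ENNReal.rpow_two, ← ENNReal.rpow_mul, ← ENNReal.rpow_mul]
      norm_num

theorem worstCaseError_sq_le (N : ℕ) (hN : 0 < N) {α : ℝ} {γ : ℕ → ℝ}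
    (hγ : ∀ j, 1 ≤ j → 0 < γ j) (z : ℕ → ℕ) (d : ℕ) :
    worstCaseError N α γ z d ^ 2 ≤ dualSum N α γ z d := by
  suffices H : worstCaseError N α γ z d ≤ dualSum N α γ z d ^ (1 / 2 : ℝ) by
    calc _ ≤ (dualSum N α γ z d ^ (1 / 2 : ℝ)) ^ 2 := by gcongr
      _ = _ := by rw [← ENNReal.rpow_two, ← ENNReal.rpow_mul]; norm_num
  refine iSup₂_le fun f hf => ?_
  obtain ⟨hf, hnorm⟩ := hf
  rw [← (hasSum_error N hN z hf).tsum_eq]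
  set D : (Fin d → ℤ) → Prop := fun h => h ≠ 0 ∧ (N : ℤ) ∣ intDot h z with hD
  have hnn : ∀ h : Fin d → ℤ, 0 ≤ ‖fourierCoef f h‖ ^ 2 / r α γ h := fun h =>
    div_nonneg (sq_nonneg _) (r_pos hγ h).le
  have hle : ∑' h : Fin d → ℤ, ENNReal.ofReal (‖fourierCoef f h‖ ^ 2 / r α γ h) ≤ 1 := by
    rw [← ENNReal.ofReal_tsum_of_nonneg hnn hf.1, ENNReal.ofReal_le_one]
    unfold korobovNorm at hnorm
    rwa [Real.sqrt_le_one] at hnorm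
  have hcs := sq_tsum_mul_le
    (fun h : Fin d → ℤ => ENNReal.ofReal (‖fourierCoef f h‖ / √(r α γ h)))
    (fun h => if D h then ENNReal.ofReal (√(r α γ h)) else 0)
  have hu : ∀ h : Fin d → ℤ, ENNReal.ofReal (‖fourierCoef f h‖ / √(r α γ h)) ^ 2 =
      ENNReal.ofReal (‖fourierCoef f h‖ ^ 2 / r α γ h) := fun h => by
    rw [← ENNReal.ofReal_pow (by positivity), div_pow, Real.sq_sqrt (r_pos hγ h).le]
  have hv : ∀ h : Fin d → ℤ, (if D h then ENNReal.ofReal (√(r α γ h)) else 0) ^ 2 =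
      if D h then ENNReal.ofReal (r α γ h) else 0 := fun h => by
    split_ifs
    · rw [← ENNReal.ofReal_pow (by positivity), Real.sq_sqrt (r_pos hγ h).le]
    · simp
  have huv : ∀ h : Fin d → ℤ, ENNReal.ofReal (‖fourierCoef f h‖ / √(r α γ h)) *
      (if D h then ENNReal.ofReal (√(r α γ h)) else 0) =
      ‖if D h then -fourierCoef f h else 0‖ₑ := fun h => by
    split_ifs
    · rw [← ENNReal.ofReal_mul (by positivity),
        div_mul_cancel₀ _ (Real.sqrt_pos.2 (r_pos hγ h)).ne', enorm_neg, ofReal_norm]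
    · simp
  simp only [hu, hv, huv] at hcs
  have h3 : ‖∑' h, (if D h then -fourierCoef f h else 0)‖ₑ ≤
      ∑' h, ‖if D h then -fourierCoef f h else 0‖ₑ := enorm_tsum_le_tsum_enorm
  have h4 : (∑' h, ‖if D h then -fourierCoef f h else 0‖ₑ) ^ 2 ≤ dualSum N α γ z d :=
    hcs.trans ((mul_le_mul_left hle _).trans (by rw [one_mul]; rfl))
  refine h3.trans ?_
  calc ∑' h, ‖if D h then -fourierCoef f h else 0‖ₑ
      = ((∑' h, ‖if D h then -fourierCoef f h else 0‖ₑ) ^ 2) ^ (1 / 2 : ℝ) := by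
        rw [← ENNReal.rpow_two, ← ENNReal.rpow_mul]
        norm_num
    _ ≤ _ := by gcongr

theorem trigPoly_mem_korobovSpace (α : ℝ) (γ : ℕ → ℝ) {d : ℕ} (F : Finset (Fin d → ℤ))
    (a : (Fin d → ℤ) → ℂ) : trigPoly F a ∈ korobovSpace α γ d := by
  constructor
  · refine summable_of_ne_finset_zero (s := F) fun h hh => ?_
    simp [fourierCoef_trigPoly, hh]
  · intro x _
    have : trigPoly F a x = ∑ h ∈ F, fourierCoef (trigPoly F a) h *
        Complex.exp (2 * Real.pi * Complex.I * dot h x) := by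
      rw [trigPoly]
      refine Finset.sum_congr rfl fun h hh => ?_
      rw [fourierCoef_trigPoly, if_pos hh]
    rw [this]
    refine hasSum_sum_of_ne_finset_zero fun h hh => ?_
    simp [fourierCoef_trigPoly, hh]

/-- The trigonometric polynomials `∑ r_α(γ, h) exp(2πi h·x)` over finite sets `G` of nonzero dual
frequencies, normalized, have error `√(∑ r_α(γ, h))`, so no convergence is needed here. -/
theorem le_worstCaseError_sq (N : ℕ) (hN : 0 < N) {α : ℝ} {γ : ℕ → ℝ}
    (hγ : ∀ j, 1 ≤ j → 0 < γ j) (z : ℕ → ℕ) (d : ℕ) :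
    dualSum N α γ z d ≤ worstCaseError N α γ z d ^ 2 := by
  refine ENNReal.summable.tsum_le_of_sum_le fun F => ?_
  rw [← Finset.sum_filter, ← ENNReal.ofReal_sum_of_nonneg fun h _ => (r_pos hγ h).le]
  set G := F.filter fun h : Fin d → ℤ => h ≠ 0 ∧ (N : ℤ) ∣ intDot h z with hG
  -- `√A` is the Korobov norm of the polynomial with coefficients `r_α(γ, h)`.
  set A : ℝ := ∑ h ∈ G, r α γ h with hA
  rcases G.eq_empty_or_nonempty with he | hne
  · simp [hA, he]
  have hA0 : 0 < A := Finset.sum_pos (fun h _ => r_pos hγ h) hne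
  set f := trigPoly G fun h => ((r α γ h / √A : ℝ) : ℂ) with hf
  have hmem := trigPoly_mem_korobovSpace α γ G fun h => ((r α γ h / √A : ℝ) : ℂ)
  have hnorm : korobovNorm α γ f ≤ 1 := by
    unfold korobovNorm
    rw [Real.sqrt_le_one, tsum_eq_sum (s := G)
      (fun h hh => by simp [hf, fourierCoef_trigPoly, hh])]
    have : ∀ h ∈ G, ‖fourierCoef f h‖ ^ 2 / r α γ h = r α γ h / A := fun h hh => by
      rw [hf, fourierCoef_trigPoly, if_pos hh, Complex.norm_real, Real.norm_eq_abs, sq_abs,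
        div_pow, Real.sq_sqrt hA0.le]
      have := (r_pos (α := α) hγ h).ne'
      field_simp
    rw [Finset.sum_congr rfl this, ← Finset.sum_div, ← hA, div_self hA0.ne']
  have herr := hasSum_error N hN z hmem
  have hval := herr.unique (hasSum_sum_of_ne_finset_zero (s := G) fun h hh => by
    simp [fourierCoef_trigPoly, hh])
  have hsum : ∑ h ∈ G, (if h ≠ 0 ∧ (N : ℤ) ∣ intDot h z then -fourierCoef f h else 0) =
      ((-√A : ℝ) : ℂ) := by
    have : ∀ h ∈ G, (if h ≠ 0 ∧ (N : ℤ) ∣ intDot h z then -fourierCoef f h else 0) =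
        ((-(r α γ h / √A) : ℝ) : ℂ) := fun h hh => by
      rw [if_pos (Finset.mem_filter.1 hh).2, hf, fourierCoef_trigPoly, if_pos hh]
      push_cast
      rfl
    rw [Finset.sum_congr rfl this, ← Complex.ofReal_sum, Finset.sum_neg_distrib,
      ← Finset.sum_div, ← hA, Real.div_sqrt]
  have hle : ENNReal.ofReal √A ≤ worstCaseError N α γ z d := by
    refine le_trans (le_of_eq ?_) (le_iSup₂ (f := fun f
      (_ : f ∈ {f ∈ korobovSpace α γ d | korobovNorm α γ f ≤ 1}) => _) f ⟨hmem, hnorm⟩)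
    rw [hval, hsum, ← ofReal_norm, Complex.norm_real, norm_neg, Real.norm_of_nonneg (by positivity)]
  calc ENNReal.ofReal A = ENNReal.ofReal √A ^ 2 := by
        rw [← ENNReal.ofReal_pow (by positivity), Real.sq_sqrt hA0.le]
    _ ≤ _ := by gcongr

theorem worstCaseError_sq_eq_dualSum (N : ℕ) (hN : 0 < N) {α : ℝ} {γ : ℕ → ℝ}
    (hγ : ∀ j, 1 ≤ j → 0 < γ j) (z : ℕ → ℕ) (d : ℕ) :
    worstCaseError N α γ z d ^ 2 = dualSum N α γ z d :=
  le_antisymm (worstCaseError_sq_le N hN hγ z d) (le_worstCaseError_sq N hN hγ z d)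

/-! ### Sums of powers over the integers and the Riemann zeta function -/

/-- The function `|k| ^ (-β)` on the nonzero integers, extended by `0` to `k = 0`. -/
noncomputable def absPow (β : ℝ) (k : ℤ) : ℝ≥0∞ :=
  if k = 0 then 0 else ENNReal.ofReal (|(k : ℝ)| ^ (-β))

theorem tsum_absPow {β : ℝ} (hβ : 1 < β) :
    ∑' k, absPow β k = ENNReal.ofReal (2 * (riemannZeta (β : ℂ)).re) := by
  set f : ℤ → ℝ := fun k => if k = 0 then 0 else |(k : ℝ)| ^ (-β) with hf
  have hf0 : ∀ k, 0 ≤ f k := fun k => by simp only [hf]; split_ifs <;> positivity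
  have hpos : ∀ n : ℕ, f (n + 1) = 1 / ((n : ℝ) + 1) ^ β := fun n => by
    have h1 : ((n : ℤ) + 1) ≠ 0 := by omega
    simp only [hf, h1, if_false]
    push_cast
    rw [abs_of_nonneg (by positivity), Real.rpow_neg (by positivity), one_div]
  have hneg : ∀ n : ℕ, f (-(n + 1)) = 1 / ((n : ℝ) + 1) ^ β := fun n => by
    rw [← hpos]
    simp only [hf, neg_eq_zero, Int.cast_neg, abs_neg]
  have hs : Summable fun n : ℕ => 1 / ((n : ℝ) + 1) ^ β := by
    refine ((Real.summable_one_div_nat_add_rpow 1 β).2 hβ).congr fun n => ?_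
    rw [abs_of_nonneg (by positivity)]
  have hz : ∑' n : ℕ, 1 / ((n : ℝ) + 1) ^ β = (riemannZeta (β : ℂ)).re := by
    rw [zeta_eq_tsum_one_div_nat_add_one_cpow (by simpa using hβ)]
    have : ∀ n : ℕ, (1 / ((n : ℂ) + 1) ^ (β : ℂ)) = ((1 / ((n : ℝ) + 1) ^ β : ℝ) : ℂ) := by
      intro n
      rw [Complex.ofReal_div, Complex.ofReal_cpow (by positivity)]
      push_cast
      rfl
    simp only [this]
    rw [← Complex.ofReal_tsum, Complex.ofReal_re]
  have hsum : HasSum f (2 * (riemannZeta (β : ℂ)).re) := by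
    have := HasSum.of_add_one_of_neg_add_one (f := f)
      (m := (riemannZeta (β : ℂ)).re) (m' := (riemannZeta (β : ℂ)).re)
      (by simp only [hpos, ← hz]; exact hs.hasSum) (by simp only [hneg, ← hz]; exact hs.hasSum)
    convert this using 1
    simp [hf]
    ring
  rw [← hsum.tsum_eq, ENNReal.ofReal_tsum_of_nonneg hf0 hsum.summable]
  refine tsum_congr fun k => ?_
  simp only [absPow, hf]
  split_ifs <;> simp

theorem zeta_re_pos {β : ℝ} (hβ : 1 < β) : 0 < (riemannZeta (β : ℂ)).re := by
  by_contra! h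
  have h1 := tsum_absPow hβ
  rw [ENNReal.ofReal_of_nonpos (by linarith), ENNReal.tsum_eq_zero] at h1
  simpa [absPow] using h1 1

/-- Summing `|k| ^ (-β)` over the multiples of `g`, each counted `g` times, gives at most the full
sum, because `g * g ^ (-β) ≤ 1`. -/
theorem tsum_dvd_mul_absPow_le {β : ℝ} (hβ : 1 < β) {g : ℕ} (hg : 0 < g) :
    ∑' k : ℤ, (if (g : ℤ) ∣ k then (g : ℝ≥0∞) else 0) * absPow β k ≤ ∑' k, absPow β k := by
  have hg0 : (g : ℤ) ≠ 0 := by exact_mod_cast hg.ne'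
  rw [← Function.Injective.tsum_eq (g := fun j : ℤ => (g : ℤ) * j) (mul_right_injective₀ hg0)]
  · refine ENNReal.tsum_le_tsum fun j => ?_
    simp only [dvd_mul_right, if_true, absPow, mul_eq_zero, hg0, false_or]
    split_ifs with hj
    · simp
    · have hj' : (0 : ℝ) < |(j : ℝ)| := abs_pos.2 (by exact_mod_cast hj)
      have hg1 : (1 : ℝ) ≤ g := by exact_mod_cast hg
      rw [← ENNReal.ofReal_natCast, ← ENNReal.ofReal_mul (by positivity)]
      refine ENNReal.ofReal_le_ofReal ?_
      push_cast
      rw [abs_mul, Nat.abs_cast, Real.mul_rpow (by positivity) hj'.le, ← mul_assoc]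
      refine mul_le_of_le_one_left (by positivity) ?_
      nth_rewrite 1 [← Real.rpow_one (g : ℝ)]
      rw [← Real.rpow_add (by positivity)]
      exact Real.rpow_le_one_of_one_le_of_nonpos hg1 (by linarith)
  · -- The summand vanishes off the multiples of `g`.
    intro k hk
    by_contra h
    refine hk ?_
    beta_reduce
    rw [if_neg, zero_mul]
    rintro ⟨j, rfl⟩
    exact h ⟨j, rfl⟩

/-! ### Counting solutions of congruences over the reduced search space -/

theorem gcd_eq_of_dvd_add_mul {M : ℕ} {c k : ℤ} {y : ℕ} (hy : Nat.Coprime y M)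
    (h : (M : ℤ) ∣ c + k * y) : Int.gcd k M = Int.gcd c M := by
  obtain ⟨t, ht⟩ := h
  have hc : c = -(k * y) + t * M := by linarith
  rw [hc, Int.gcd_add_mul_right_left, Int.neg_gcd, Int.gcd_comm, Int.gcd_comm (k * y),
    mul_comm, Int.gcd_mul_right_right_of_gcd_eq_one]
  rw [Int.gcd_natCast_natCast]
  exact hy.symm

/-- A linear congruence `c + k y ≡ 0` modulo `M` has at most `gcd(k, M)` solutions `y` in
`{1, …, M}`. -/
theorem card_solutions_le {M : ℕ} {c k : ℤ} (hM : 0 < M) {Y : Finset ℕ}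
    (hY : ∀ y ∈ Y, 1 ≤ y ∧ y ≤ M ∧ (M : ℤ) ∣ c + k * y) : Y.card ≤ Int.gcd k M := by
  set g := Int.gcd k M with hg
  have hgpos : 0 < g := Int.gcd_pos_of_ne_zero_right _ (by exact_mod_cast hM.ne')
  obtain ⟨n, hn⟩ : g ∣ M := by exact_mod_cast Int.gcd_dvd_right k (M : ℤ)
  have hnpos : 0 < n := Nat.pos_of_ne_zero fun h => by simp [h] at hn; omega
  obtain ⟨q, hq⟩ : (g : ℤ) ∣ k := Int.gcd_dvd_left k (M : ℤ)
  have hcop : IsCoprime (n : ℤ) q := by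
    have h1 : g = g * Int.gcd q n := by
      conv_lhs => rw [hg, hq, hn]
      push_cast
      rw [Int.gcd_mul_left]
      simp
    have h2 : Int.gcd q n = 1 := by
      have := Nat.eq_of_mul_eq_mul_left hgpos ((mul_one g).trans h1)
      exact this.symm
    exact (Int.isCoprime_iff_gcd_eq_one.2 h2).symm
  -- Solutions agree modulo `n = M / g`, so the block `(y - 1) / n` of length `n` determines `y`.
  rw [← Finset.card_range g]
  refine Finset.card_le_card_of_injOn (fun y => (y - 1) / n) (fun y hy => ?_) ?_
  · obtain ⟨h1, h2, -⟩ := hY y hy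
    simp only [Finset.coe_range, Set.mem_Iio]
    rw [Nat.div_lt_iff_lt_mul hnpos, ← hn]
    omega
  · intro y hy y' hy' heq
    obtain ⟨h1, -, h3⟩ := hY y hy
    obtain ⟨h1', -, h3'⟩ := hY y' hy'
    have hdvd : (M : ℤ) ∣ k * ((y : ℤ) - y') := by
      have := dvd_sub h3 h3'
      rwa [add_sub_add_left_eq_sub, ← mul_sub] at this
    rw [hq, hn] at hdvd
    push_cast at hdvd
    rw [mul_assoc, mul_dvd_mul_iff_left (by exact_mod_cast hgpos.ne')] at hdvd
    have hmod := hcop.dvd_of_dvd_mul_left hdvd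
    have hmod' : (y - 1) % n = (y' - 1) % n := by
      have : ((y' - 1 : ℕ) : ℤ) ≡ ((y - 1 : ℕ) : ℤ) [ZMOD n] := by
        rw [Int.modEq_iff_dvd]
        push_cast [h1, h1']
        simpa using hmod
      exact (Int.natCast_modEq_iff.1 this).symm
    have e1 := Nat.div_add_mod (y - 1) n
    have e2 := Nat.div_add_mod (y' - 1) n
    simp only at heq
    rw [heq, hmod'] at e1
    omega

theorem mem_reducedSpace {b m w y : ℕ} (hy : y ∈ reducedSpace b m w) :
    1 ≤ y ∧ y ≤ b ^ (m - w) ∧ Nat.Coprime y (b ^ (m - w)) := by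
  unfold reducedSpace at hy
  split_ifs at hy with h
  · simp only [Finset.mem_filter, Finset.mem_Icc] at hy
    exact ⟨hy.1.1, hy.1.2.trans (Nat.sub_le _ _),
      Nat.Coprime.coprime_dvd_right (pow_dvd_pow _ (Nat.sub_le _ _)) hy.2⟩
  · rw [Finset.mem_singleton] at hy
    simp [hy, Nat.sub_eq_zero_of_le (not_lt.1 h)]

/-- For every residue `c`, each solution of `c + k b ^ w y ≡ 0` modulo `b ^ m` solves a congruence
`c' + k y ≡ 0` modulo `b ^ (m - w)`, with `c'` depending only on `c`. For `w > m` truncated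
subtraction makes the second modulus `1`. -/
theorem exists_reduced_congruence {b : ℕ} (hb : 0 < b) (m w : ℕ) (c : ℤ) :
    ∃ c' : ℤ, ∀ k : ℤ, ∀ y : ℕ, ((b ^ m : ℕ) : ℤ) ∣ c + k * ((b ^ w * y : ℕ) : ℤ) →
      ((b ^ (m - w) : ℕ) : ℤ) ∣ c' + k * y := by
  rcases le_or_gt w m with h | h
  · by_cases hc : ((b ^ w : ℕ) : ℤ) ∣ c
    · obtain ⟨c', rfl⟩ := hc
      refine ⟨c', fun k y hd => ?_⟩
      rw [← Nat.add_sub_of_le h, pow_add] at hd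
      push_cast at hd ⊢
      have hbw : ((b : ℤ) ^ w) ≠ 0 := pow_ne_zero _ (by exact_mod_cast hb.ne')
      rw [show (b : ℤ) ^ w * c' + k * (b ^ w * y) = b ^ w * (c' + k * y) by ring,
        mul_dvd_mul_iff_left hbw] at hd
      simpa using hd
    · refine ⟨0, fun k y hd => absurd ?_ hc⟩
      have h1 : ((b ^ w : ℕ) : ℤ) ∣ ((b ^ m : ℕ) : ℤ) := by exact_mod_cast pow_dvd_pow b h
      refine (Int.dvd_add_left ?_).1 (h1.trans hd)
      push_cast
      exact (dvd_mul_right _ _).mul_left _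
  · exact ⟨0, fun k y _ => by simp [Nat.sub_eq_zero_of_le h.le]⟩

/-- Averaging over the search space: for every residue `c`, the sum of `|k| ^ (-β)` over the
solutions `(y, k)` of `c + k b ^ w y ≡ 0` modulo `b ^ m` is at most `2 ζ(β)`. Every solution has the
same `g = gcd(k, b ^ (m - w))`, and a given `k` occurs with at most `g` values of `y`. -/
theorem sum_reducedSpace_tsum_absPow_le {b m w : ℕ} (hb : b.Prime) {β : ℝ} (hβ : 1 < β) (c : ℤ) :
    ∑ y ∈ reducedSpace b m w, ∑' k : ℤ,
      (if ((b ^ m : ℕ) : ℤ) ∣ c + k * ((b ^ w * y : ℕ) : ℤ) then absPow β k else 0) ≤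
        ∑' k, absPow β k := by
  obtain ⟨c', hc'⟩ := exists_reduced_congruence hb.pos m w c
  have hM : 0 < b ^ (m - w) := pow_pos hb.pos _
  have hg : 0 < Int.gcd c' (b ^ (m - w) : ℕ) :=
    Int.gcd_pos_of_ne_zero_right _ (by exact_mod_cast hM.ne')
  rw [← Summable.tsum_finsetSum fun _ _ => ENNReal.summable]
  refine le_trans (ENNReal.tsum_le_tsum fun k => ?_) (tsum_dvd_mul_absPow_le hβ hg)
  rw [← Finset.sum_filter, Finset.sum_const, nsmul_eq_mul]
  gcongr
  set Y := (reducedSpace b m w).filter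
    fun y => ((b ^ m : ℕ) : ℤ) ∣ c + k * ((b ^ w * y : ℕ) : ℤ) with hYdef
  have hY : ∀ y ∈ Y, 1 ≤ y ∧ y ≤ b ^ (m - w) ∧ ((b ^ (m - w) : ℕ) : ℤ) ∣ c' + k * y := by
    intro y hy
    obtain ⟨hy1, hy2⟩ := Finset.mem_filter.1 hy
    obtain ⟨h1, h2, -⟩ := mem_reducedSpace hy1
    exact ⟨h1, h2, hc' k y hy2⟩
  rcases Y.eq_empty_or_nonempty with he | ⟨y, hy⟩
  · simp [he]
  · have hgcd := gcd_eq_of_dvd_add_mul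
      (mem_reducedSpace (Finset.mem_filter.1 hy).1).2.2 (hY y hy).2.2
    rw [if_pos (hgcd ▸ Int.gcd_dvd_left k _), ← hgcd]
    exact_mod_cast card_solutions_le hM hY

/-! ### Adding a component to the generating vector -/

/-- The contribution to `dualSum` in dimension `d + 1` of the frequencies with nonzero last entry,
as a function of the last component `v` of the generating vector. -/
noncomputable def lastSum (N : ℕ) (α : ℝ) (γ : ℕ → ℝ) (z : ℕ → ℕ) (d v : ℕ) : ℝ≥0∞ :=
  ∑' h : Fin d → ℤ, ∑' k : ℤ, if k ≠ 0 ∧ (N : ℤ) ∣ intDot h z + k * (v : ℤ) then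
    ENNReal.ofReal (r α γ h) * ENNReal.ofReal (rOne α (γ (d + 1)) k) else 0

theorem tsum_snoc {d : ℕ} (f : (Fin (d + 1) → ℤ) → ℝ≥0∞) :
    ∑' h, f h = ∑' h : Fin d → ℤ, ∑' k : ℤ, f (Fin.snoc h k) := by
  rw [ENNReal.tsum_comm, ← ENNReal.tsum_prod,
    ← (Fin.snocEquiv fun _ : Fin (d + 1) => ℤ).tsum_eq]
  rfl

theorem r_snoc {α : ℝ} {γ : ℕ → ℝ} {d : ℕ} (h : Fin d → ℤ) (k : ℤ) :
    r α γ (Fin.snoc h k : Fin (d + 1) → ℤ) = r α γ h * rOne α (γ (d + 1)) k := by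
  simp [r, Fin.prod_univ_castSucc]

theorem intDot_snoc {d : ℕ} (h : Fin d → ℤ) (k : ℤ) (z : ℕ → ℕ) :
    intDot (Fin.snoc h k : Fin (d + 1) → ℤ) z = intDot h z + k * (z (d + 1) : ℤ) := by
  simp [intDot, Fin.sum_univ_castSucc]

theorem snoc_eq_zero_iff {d : ℕ} (h : Fin d → ℤ) (k : ℤ) :
    (Fin.snoc h k : Fin (d + 1) → ℤ) = 0 ↔ h = 0 ∧ k = 0 := by
  rw [funext_iff, Fin.forall_fin_succ']
  simp [funext_iff]

theorem dualSum_succ (N : ℕ) {α : ℝ} {γ : ℕ → ℝ} (hγ : ∀ j, 1 ≤ j → 0 < γ j) (z : ℕ → ℕ) (d : ℕ) :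
    dualSum N α γ z (d + 1) = dualSum N α γ z d + lastSum N α γ z d (z (d + 1)) := by
  rw [dualSum, tsum_snoc, dualSum, lastSum, ← ENNReal.tsum_add]
  refine tsum_congr fun h => ?_
  rw [← tsum_ite_eq (0 : ℤ) (fun _ => if h ≠ 0 ∧ (N : ℤ) ∣ intDot h z then
    ENNReal.ofReal (r α γ h) else 0), ← ENNReal.tsum_add]
  refine tsum_congr fun k => ?_
  rw [r_snoc, intDot_snoc, ENNReal.ofReal_mul (r_pos hγ h).le]
  simp only [ne_eq, snoc_eq_zero_iff]
  by_cases hk : k = 0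
  · simp [hk, rOne]
  · simp [hk]

theorem dualSum_congr (N : ℕ) {α : ℝ} {γ : ℕ → ℝ} {z z' : ℕ → ℕ} {d : ℕ}
    (h : ∀ i, 1 ≤ i → i ≤ d → z i = z' i) : dualSum N α γ z d = dualSum N α γ z' d := by
  have : ∀ k : Fin d → ℤ, intDot k z = intDot k z' := fun k =>
    Finset.sum_congr rfl fun i _ => by rw [h _ (by omega) (by omega)]
  simp only [dualSum, this]

theorem lastSum_congr (N : ℕ) {α : ℝ} {γ : ℕ → ℝ} {z z' : ℕ → ℕ} {d : ℕ}
    (h : ∀ i, 1 ≤ i → i ≤ d → z i = z' i) (v : ℕ) :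
    lastSum N α γ z d v = lastSum N α γ z' d v := by
  have : ∀ k : Fin d → ℤ, intDot k z = intDot k z' := fun k =>
    Finset.sum_congr rfl fun i _ => by rw [h _ (by omega) (by omega)]
  simp only [lastSum, this]

theorem dualSum_zero (N : ℕ) (α : ℝ) (γ : ℕ → ℝ) (z : ℕ → ℕ) : dualSum N α γ z 0 = 0 := by
  refine ENNReal.tsum_eq_zero.2 fun h => if_neg fun hh => hh.1 (Subsingleton.elim _ _)

/-- Jensen's inequality `(∑ aᵢ) ^ p ≤ ∑ aᵢ ^ p` for `0 < p ≤ 1`. -/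
theorem tsum_rpow_le {ι : Type*} (a : ι → ℝ≥0∞) {p : ℝ} (hp : 0 < p) (hp1 : p ≤ 1) :
    (∑' i, a i) ^ p ≤ ∑' i, a i ^ p := by
  have hfin : ∀ s : Finset ι, (∑ i ∈ s, a i) ^ p ≤ ∑ i ∈ s, a i ^ p := fun s =>
    Finset.le_sum_of_subadditive (· ^ p) (ENNReal.zero_rpow_of_pos hp).le
      (fun x y => ENNReal.rpow_add_le_add_rpow x y hp.le hp1) s a
  rw [← ENNReal.le_rpow_inv_iff hp]
  refine ENNReal.summable.tsum_le_of_sum_le fun s => ?_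
  rw [ENNReal.le_rpow_inv_iff hp]
  exact (hfin s).trans (ENNReal.sum_le_tsum s)

theorem ofReal_rOne_rpow {α g lam : ℝ} (hg : 0 < g) {k : ℤ} (hk : k ≠ 0) :
    ENNReal.ofReal (rOne α g k) ^ lam = ENNReal.ofReal (g ^ lam) * absPow (α * lam) k := by
  have hk' : (0 : ℝ) < |(k : ℝ)| := abs_pos.2 (by exact_mod_cast hk)
  rw [ENNReal.ofReal_rpow_of_pos (rOne_pos hg k), absPow, if_neg hk,
    ← ENNReal.ofReal_mul (by positivity), rOne, if_neg hk, Real.div_rpow hg.le (by positivity),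
    ← Real.rpow_mul hk'.le, Real.rpow_neg hk'.le, div_eq_mul_inv]

/-- The sum `∑ r_α(γ, h) ^ lam` over all integer vectors factors over the coordinates. -/
theorem tsum_r_rpow {α : ℝ} {γ : ℕ → ℝ} (hγ : ∀ j, 1 ≤ j → 0 < γ j) {lam : ℝ}
    (hβ : 1 < α * lam) (d : ℕ) :
    ∑' h : Fin d → ℤ, ENNReal.ofReal (r α γ h) ^ lam = ENNReal.ofReal
      (∏ j ∈ Finset.Icc 1 d, (1 + γ j ^ lam * (2 * (riemannZeta ((α * lam : ℝ) : ℂ)).re))) := by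
  have hζ := zeta_re_pos hβ
  induction d with
  | zero => simp [r]
  | succ d ih =>
    have hg := hγ (d + 1) (by omega)
    have h1 : ∑' k : ℤ, ENNReal.ofReal (rOne α (γ (d + 1)) k) ^ lam =
        ENNReal.ofReal (1 + γ (d + 1) ^ lam * (2 * (riemannZeta ((α * lam : ℝ) : ℂ)).re)) := by
      rw [ENNReal.ofReal_add zero_le_one (by positivity), ENNReal.ofReal_mul (by positivity),
        ← tsum_absPow hβ, ← ENNReal.tsum_mul_left, ENNReal.ofReal_one,
        ← tsum_ite_eq (0 : ℤ) (fun _ => (1 : ℝ≥0∞)), ← ENNReal.tsum_add]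
      refine tsum_congr fun k => ?_
      by_cases hk : k = 0
      · simp [hk, rOne, absPow]
      · rw [ofReal_rOne_rpow hg hk]
        simp [hk]
    rw [tsum_snoc, Finset.prod_Icc_succ_top (by omega), ENNReal.ofReal_mul, ← ih, ← h1,
      ← ENNReal.tsum_mul_right]
    · refine tsum_congr fun h => ?_
      rw [← ENNReal.tsum_mul_left]
      refine tsum_congr fun k => ?_
      rw [r_snoc, ENNReal.ofReal_mul (r_pos hγ h).le,
        ENNReal.mul_rpow_of_ne_top ENNReal.ofReal_ne_top ENNReal.ofReal_ne_top]
    · exact Finset.prod_nonneg fun j hj => by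
        have := hγ j (Finset.mem_Icc.1 hj).1
        positivity

/-- The averaging argument of the component-by-component construction: the `lam`-th powers of
`lastSum`, summed over the whole reduced search space, are controlled by the full Korobov sum. -/
theorem sum_lastSum_rpow_le {b m w : ℕ} (hb : b.Prime) {α : ℝ} {γ : ℕ → ℝ}
    (hγ : ∀ j, 1 ≤ j → 0 < γ j) {lam : ℝ} (hlam : 0 < lam) (hlam_one : lam ≤ 1)
    (hβ : 1 < α * lam) (z : ℕ → ℕ) (d : ℕ) :
    ∑ y ∈ reducedSpace b m w, lastSum (b ^ m) α γ z d (b ^ w * y) ^ lam ≤ ENNReal.ofReal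
      ((∏ j ∈ Finset.Icc 1 d, (1 + γ j ^ lam * (2 * (riemannZeta ((α * lam : ℝ) : ℂ)).re))) *
        (γ (d + 1) ^ lam * (2 * (riemannZeta ((α * lam : ℝ) : ℂ)).re))) := by
  have hζ := zeta_re_pos hβ
  have hg := hγ (d + 1) (by omega)
  rw [ENNReal.ofReal_mul', ENNReal.ofReal_mul (by positivity), ← tsum_absPow hβ,
    ← tsum_r_rpow hγ hβ, ← ENNReal.tsum_mul_right]
  swap
  · positivity
  have hy : ∀ y, lastSum (b ^ m) α γ z d (b ^ w * y) ^ lam ≤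
      ∑' h : Fin d → ℤ, ENNReal.ofReal (r α γ h) ^ lam * (ENNReal.ofReal (γ (d + 1) ^ lam) *
        ∑' k : ℤ, if ((b ^ m : ℕ) : ℤ) ∣ intDot h z + k * ((b ^ w * y : ℕ) : ℤ) then
          absPow (α * lam) k else 0) := by
    intro y
    refine (tsum_rpow_le _ hlam hlam_one).trans (ENNReal.tsum_le_tsum fun h => ?_)
    refine (tsum_rpow_le _ hlam hlam_one).trans ?_
    rw [← ENNReal.tsum_mul_left, ← ENNReal.tsum_mul_left]
    refine ENNReal.tsum_le_tsum fun k => ?_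
    split_ifs with h1 h2 h2
    · rw [ENNReal.mul_rpow_of_ne_top ENNReal.ofReal_ne_top ENNReal.ofReal_ne_top,
        ofReal_rOne_rpow hg h1.1]
    · exact absurd h1.2 h2
    · simp [ENNReal.zero_rpow_of_pos hlam]
    · simp [ENNReal.zero_rpow_of_pos hlam]
  refine (Finset.sum_le_sum fun y _ => hy y).trans ?_
  rw [← Summable.tsum_finsetSum fun _ _ => ENNReal.summable]
  refine ENNReal.tsum_le_tsum fun h => ?_
  rw [← Finset.mul_sum, ← Finset.mul_sum]
  gcongr
  exact sum_reducedSpace_tsum_absPow_le hb hβ _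

/-! ### The inductive bound for the component-by-component construction -/

theorem card_searchSpace {N : ℕ} (hN : 2 ≤ N) : (searchSpace N).card = Nat.totient N := by
  rw [Nat.totient_eq_card_coprime]
  congr 1
  ext z
  simp only [searchSpace, Finset.mem_filter, Finset.mem_Icc, Finset.mem_range,
    Nat.coprime_comm (m := N), Nat.coprime_iff_gcd_eq_one]
  constructor
  · rintro ⟨⟨h1, h2⟩, h3⟩
    exact ⟨by omega, h3⟩
  · rintro ⟨h1, h2⟩
    refine ⟨⟨Nat.pos_of_ne_zero ?_, by omega⟩, h2⟩
    rintro rfl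
    simp at h2
    omega

theorem reducedSpace_subset {b m w : ℕ} (hb : b.Prime) (hm : 1 ≤ m) :
    reducedSpace b m w ⊆ searchSpace (b ^ m) := by
  intro y hy
  have hN : 1 < b ^ m := Nat.one_lt_pow (by omega) hb.one_lt
  unfold reducedSpace at hy
  simp only [searchSpace, Finset.mem_filter, Finset.mem_Icc]
  split_ifs at hy with h
  · simp only [Finset.mem_filter, Finset.mem_Icc] at hy
    have : b ^ (m - w) ≤ b ^ m := Nat.pow_le_pow_right hb.pos (Nat.sub_le _ _)
    exact ⟨⟨hy.1.1, by omega⟩, hy.2⟩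
  · rw [Finset.mem_singleton] at hy
    subst hy
    exact ⟨⟨le_rfl, by omega⟩, by simp⟩

/-- `φ(N) - |ℰ̃|` is the number of candidates among which the algorithm chooses. -/
theorem totient_sub_card_auxExclusion {b m w : ℕ} (hb : b.Prime) (hm : 1 ≤ m) {E : Finset ℕ}
    (hE : E ⊆ reducedSpace b m w) :
    (Nat.totient (b ^ m) : ℝ) - ((auxExclusion b m w E).card : ℝ) =
      ((reducedSpace b m w \ E).card : ℝ) := by
  have hN : 2 ≤ b ^ m := Nat.one_lt_pow (by omega) hb.one_lt
  have hdisj : Disjoint (searchSpace (b ^ m) \ reducedSpace b m w) E :=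
    Finset.disjoint_of_subset_right hE Finset.sdiff_disjoint
  have h1 := Finset.card_sdiff_add_card_eq_card (reducedSpace_subset (w := w) hb hm)
  have h2 := Finset.card_sdiff_add_card_eq_card hE
  rw [auxExclusion, Finset.card_union_of_disjoint hdisj, ← card_searchSpace hN, ← h1, ← h2]
  push_cast
  ring

theorem lastSum_eq_of_dvd_iff {N : ℕ} {α : ℝ} {γ : ℕ → ℝ} {z : ℕ → ℕ} {d v v' : ℕ}
    (h : ∀ (c : Fin d → ℤ) (k : ℤ), (N : ℤ) ∣ intDot c z + k * (v : ℤ) ↔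
      (N : ℤ) ∣ intDot c z + k * (v' : ℤ)) :
    lastSum N α γ z d v = lastSum N α γ z d v' := by
  simp only [lastSum, h]

section Output

variable {b m : ℕ} {w : ℕ → ℕ} {α : ℝ} {γ : ℕ → ℝ} {s : ℕ} {E : ℕ → Finset ℕ} {z zt : ℕ → ℕ}

theorem IsOutput.exclusion_ssubset_reducedSpace (hz : IsOutput b m w α γ s E z zt)
    (hb : b.Prime) (hm : 1 ≤ m) (hw : w 1 = 0) {j : ℕ} (hj : 1 ≤ j) (hjs : j ≤ s) :
    E j ⊂ reducedSpace b m (w j) := by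
  rcases hj.eq_or_lt with rfl | hj
  · rw [hz.exclusion_one, hw, Finset.empty_ssubset]
    refine ⟨1, ?_⟩
    have hN : 1 < b ^ m := Nat.one_lt_pow (by omega) hb.one_lt
    simp only [reducedSpace, show 0 < m by omega, if_true, Finset.mem_filter, Finset.mem_Icc]
    exact ⟨⟨le_rfl, by simp; omega⟩, by simp⟩
  · rcases lt_or_ge (w j) m with h | h
    · exact hz.exclusion_ssubset j hj hjs h
    · rw [hz.exclusion_late j hj hjs h, Finset.empty_ssubset, reducedSpace, if_neg (by omega)]
      exact Finset.singleton_nonempty 1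

/-- In every step, the component produced by the algorithm minimizes `lastSum` over the candidates.
This covers the two components that are not found by a search: for `j = 1` all candidates are
equally good, and for `w j ≥ m` the only candidate is congruent to `0` modulo `b ^ m`. -/
theorem IsOutput.lastSum_le (hz : IsOutput b m w α γ s E z zt)
    (hb : b.Prime) (hw : w 1 = 0) (hγ : ∀ j, 1 ≤ j → 0 < γ j) {d : ℕ} (hd : d + 1 ≤ s)
    (hfin : dualSum (b ^ m) α γ zt d ≠ ⊤) {y : ℕ}
    (hy : y ∈ reducedSpace b m (w (d + 1)) \ E (d + 1)) :
    lastSum (b ^ m) α γ zt d (zt (d + 1)) ≤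
      lastSum (b ^ m) α γ zt d (b ^ w (d + 1) * y) := by
  have hN : 0 < b ^ m := pow_pos hb.pos m
  rcases Nat.eq_zero_or_pos d with rfl | hdpos
  · refine (lastSum_eq_of_dvd_iff fun c k => ?_).le
    have hcop := (mem_reducedSpace (Finset.mem_sdiff.1 hy).1).2.2
    rw [zero_add, hw, Nat.sub_zero] at hcop
    have h1 : IsCoprime ((b ^ m : ℕ) : ℤ) (y : ℤ) := Nat.isCoprime_iff_coprime.2 hcop.symm
    simp only [intDot, Finset.univ_eq_empty, Finset.sum_empty, zero_add, hz.zt_one, hz.z_one, hw,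
      pow_zero, one_mul, Nat.cast_one, mul_one]
    exact ⟨fun h => h.mul_right _, fun h => h1.dvd_of_dvd_mul_right h⟩
  rcases lt_or_ge (w (d + 1)) m with h | h
  · have hmin := hz.z_min (d + 1) (by omega) hd h y hy
    have hcongr : ∀ v i, 1 ≤ i → i ≤ d → Function.update zt (d + 1) v i = zt i := fun v i _ hi =>
      Function.update_of_ne (by omega) _ _
    rw [← hz.zt_eq (d + 1) (by omega) hd h, worstCaseError_sq_eq_dualSum _ hN hγ,
      worstCaseError_sq_eq_dualSum _ hN hγ, dualSum_succ _ hγ, dualSum_succ _ hγ,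
      dualSum_congr _ (hcongr _), dualSum_congr _ (hcongr _), lastSum_congr _ (hcongr _),
      lastSum_congr _ (hcongr _), Function.update_self, Function.update_self] at hmin
    exact (ENNReal.add_le_add_iff_left hfin).1 hmin
  · refine (lastSum_eq_of_dvd_iff fun c k => ?_).le
    have h1 : ((b ^ m : ℕ) : ℤ) ∣ k * ((b ^ w (d + 1) * y : ℕ) : ℤ) :=
      (Int.natCast_dvd_natCast.2 ((pow_dvd_pow b h).mul_right y)).mul_left k
    rw [hz.zt_late (d + 1) (by omega) hd h, hz.z_late (d + 1) (by omega) hd h, Int.dvd_add_left h1]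
    simp

/-- The error bound in product form, with `φ(N) - |ℰ̃|` written as the number of candidates. -/
theorem IsOutput.dualSum_rpow_le (hz : IsOutput b m w α γ s E z zt)
    (hb : b.Prime) (hm : 1 ≤ m) (hw : w 1 = 0) (hγ : ∀ j, 1 ≤ j → 0 < γ j)
    {lam : ℝ} (hlam : 0 < lam) (hlam_one : lam ≤ 1) (hβ : 1 < α * lam) {d : ℕ} (hd : d ≤ s) :
    dualSum (b ^ m) α γ zt d ^ lam ≤ ENNReal.ofReal
      (1 / (Nat.totient (b ^ m) : ℝ) * ∏ j ∈ Finset.Icc 1 d,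
        (1 + γ j ^ lam * (2 * (riemannZeta ((α * lam : ℝ) : ℂ)).re) *
          ((Nat.totient (b ^ m) : ℝ) / ((reducedSpace b m (w j) \ E j).card : ℝ)))) := by
  have hφ : (0 : ℝ) < Nat.totient (b ^ m) := by
    exact_mod_cast Nat.totient_pos.2 (pow_pos hb.pos m)
  set Z : ℝ := 2 * (riemannZeta ((α * lam : ℝ) : ℂ)).re with hZ
  have hZpos : 0 < Z := mul_pos two_pos (zeta_re_pos hβ)
  induction d with
  | zero => simp [dualSum_zero, ENNReal.zero_rpow_of_pos hlam]
  | succ d ih =>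
    specialize ih (by omega)
    have hfin : dualSum (b ^ m) α γ zt d ≠ ⊤ := fun h => by
      rw [h, ENNReal.top_rpow_of_pos hlam] at ih
      exact ENNReal.ofReal_ne_top (top_le_iff.1 ih)
    have hss : ∀ j ∈ Finset.Icc 1 (d + 1), E j ⊂ reducedSpace b m (w j) := fun j hj =>
      hz.exclusion_ssubset_reducedSpace hb hm hw (Finset.mem_Icc.1 hj).1
        ((Finset.mem_Icc.1 hj).2.trans hd)
    have hcard : ∀ j ∈ Finset.Icc 1 (d + 1),
        (0 : ℝ) < ((reducedSpace b m (w j) \ E j).card : ℝ) := fun j hj => by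
      exact_mod_cast Finset.card_pos.2 (Finset.sdiff_nonempty.2 (hss j hj).2)
    have hcard_le : ∀ j, ((reducedSpace b m (w j) \ E j).card : ℝ) ≤ Nat.totient (b ^ m) := by
      intro j
      rw [← card_searchSpace (Nat.one_lt_pow (by omega) hb.one_lt)]
      exact_mod_cast Finset.card_le_card
        (Finset.sdiff_subset.trans (reducedSpace_subset hb hm))
    set n : ℕ := (reducedSpace b m (w (d + 1)) \ E (d + 1)).card with hn
    have hnpos : (0 : ℝ) < n := hcard (d + 1) (by simp)
    set P : ℝ := ∏ j ∈ Finset.Icc 1 d, (1 + γ j ^ lam * Z *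
      ((Nat.totient (b ^ m) : ℝ) / ((reducedSpace b m (w j) \ E j).card : ℝ))) with hP
    have hgpos : 0 < γ (d + 1) ^ lam := Real.rpow_pos_of_pos (hγ _ (by omega)) _
    have hP_ge : ∏ j ∈ Finset.Icc 1 d, (1 + γ j ^ lam * Z) ≤ P := by
      refine Finset.prod_le_prod (fun j hj => ?_) fun j hj => ?_
      · have := hγ j (Finset.mem_Icc.1 hj).1
        positivity
      · have h0 := hγ j (Finset.mem_Icc.1 hj).1
        have h1 := hcard j (Finset.Icc_subset_Icc_right (Nat.le_succ d) hj)
        exact add_le_add le_rfl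
          (le_mul_of_one_le_right (by positivity) ((one_le_div h1).2 (hcard_le j)))
    have hPpos : 0 < P := lt_of_lt_of_le (Finset.prod_pos fun j hj => by
      have := hγ j (Finset.mem_Icc.1 hj).1
      positivity) hP_ge
    -- The minimum over the candidates is at most their average.
    have hT : lastSum (b ^ m) α γ zt d (zt (d + 1)) ^ lam ≤
        ENNReal.ofReal (P * (γ (d + 1) ^ lam * Z) / n) := by
      rw [ENNReal.ofReal_div_of_pos hnpos, ENNReal.ofReal_natCast, ENNReal.le_div_iff_mul_le
        (Or.inl (by exact_mod_cast hnpos.ne')) (Or.inl (ENNReal.natCast_ne_top n)), mul_comm,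
        ← nsmul_eq_mul]
      calc n • lastSum (b ^ m) α γ zt d (zt (d + 1)) ^ lam
          ≤ ∑ y ∈ reducedSpace b m (w (d + 1)) \ E (d + 1),
              lastSum (b ^ m) α γ zt d (b ^ w (d + 1) * y) ^ lam :=
            Finset.card_nsmul_le_sum _ _ _ fun y hy =>
              ENNReal.rpow_le_rpow (hz.lastSum_le hb hw hγ hd hfin hy) hlam.le
        _ ≤ ∑ y ∈ reducedSpace b m (w (d + 1)),
              lastSum (b ^ m) α γ zt d (b ^ w (d + 1) * y) ^ lam :=
            Finset.sum_le_sum_of_subset Finset.sdiff_subset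
        _ ≤ _ := sum_lastSum_rpow_le hb hγ hlam hlam_one hβ zt d
        _ ≤ _ := ENNReal.ofReal_le_ofReal (by gcongr)
    rw [dualSum_succ _ hγ]
    refine (ENNReal.rpow_add_le_add_rpow _ _ hlam.le hlam_one).trans ((add_le_add ih hT).trans ?_)
    rw [← ENNReal.ofReal_add (by positivity) (by positivity),
      Finset.prod_Icc_succ_top (by omega), ← hP, ← hn]
    refine ENNReal.ofReal_le_ofReal (le_of_eq ?_)
    field_simp

end Output

end CombinedCBC

theorem mainTheorem2 (s b m : ℕ) (hs : 1 ≤ s) (hb : b.Prime) (hm : 1 ≤ m)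
    (w : ℕ → ℕ) (hw_one : w 1 = 0) (hw_mono : ∀ i j, 1 ≤ i → i ≤ j → w i ≤ w j)
    (α : ℝ) (hα : 1 < α) (γ : ℕ → ℝ) (hγ : ∀ j, 1 ≤ j → 0 < γ j)
    (E : ℕ → Finset ℕ) (z zt : ℕ → ℕ)
    (hz : CombinedCBC.IsOutput b m w α γ s E z zt)
    (d : ℕ) (hd_one : 1 ≤ d) (hd : d ≤ s) (lam : ℝ) (hlam : 1 / α < lam) (hlam_one : lam ≤ 1) :
    CombinedCBC.worstCaseError (b ^ m) α γ zt d ^ 2 ≤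
      ENNReal.ofReal
        ((1 / (Nat.totient (b ^ m) : ℝ) *
          ∑ u ∈ (Finset.Icc 1 d).powerset,
            (∏ j ∈ u, γ j) ^ lam *
              (2 * (riemannZeta ((α * lam : ℝ) : ℂ)).re) ^ u.card *
              ∏ j ∈ u, (Nat.totient (b ^ m) : ℝ) /
                ((Nat.totient (b ^ m) : ℝ) -
                  ((CombinedCBC.auxExclusion b m (w j) (E j)).card : ℝ))) ^ (1 / lam)) := by
  have hα0 : 0 < α := by linarith
  have hlam0 : 0 < lam := (by positivity : 0 < 1 / α).trans hlam
  have hβ : 1 < α * lam := by rwa [div_lt_iff₀' hα0] at hlam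
  have hsum : ∑ u ∈ (Finset.Icc 1 d).powerset, (∏ j ∈ u, γ j) ^ lam *
        (2 * (riemannZeta ((α * lam : ℝ) : ℂ)).re) ^ u.card *
        ∏ j ∈ u, (Nat.totient (b ^ m) : ℝ) / ((Nat.totient (b ^ m) : ℝ) -
          ((CombinedCBC.auxExclusion b m (w j) (E j)).card : ℝ)) =
      ∏ j ∈ Finset.Icc 1 d,
        (1 + γ j ^ lam * (2 * (riemannZeta ((α * lam : ℝ) : ℂ)).re) *
          ((Nat.totient (b ^ m) : ℝ) / ((CombinedCBC.reducedSpace b m (w j) \ E j).card : ℝ))) := by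
    rw [Finset.prod_one_add]
    refine Finset.sum_congr rfl fun u hu => ?_
    have hu' : ∀ j ∈ u, 1 ≤ j ∧ j ≤ d := fun j hj =>
      Finset.mem_Icc.1 (Finset.mem_powerset.1 hu hj)
    rw [Finset.prod_mul_distrib, Finset.prod_mul_distrib, Finset.prod_const,
      Real.finsetProd_rpow _ _ fun j hj => (hγ j (hu' j hj).1).le]
    congr 1
    refine Finset.prod_congr rfl fun j hj => ?_
    rw [CombinedCBC.totient_sub_card_auxExclusion hb hm
      (hz.exclusion_ssubset_reducedSpace hb hm hw_one (hu' j hj).1 ((hu' j hj).2.trans hd)).subset]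
  have hζ := CombinedCBC.zeta_re_pos hβ
  rw [hsum, CombinedCBC.worstCaseError_sq_eq_dualSum _ (pow_pos hb.pos m) hγ,
    ← ENNReal.ofReal_rpow_of_nonneg _ (by positivity), one_div lam, ENNReal.le_rpow_inv_iff hlam0]
  · exact hz.dualSum_rpow_le hb hm hw_one hγ hlam0 hlam_one hβ hd
  · refine mul_nonneg (by positivity) (Finset.prod_nonneg fun j hj => ?_)
    have := hγ j (Finset.mem_Icc.1 hj).1
    positivity
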